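/- Proposition 4.1 (Non-diagonal spiked covariance models). For each $n\ge 1$ let $p=p(n)\ge 1$ and $0\le k=k(n)\le p$ be integers, put $\gamma_n=p/n$, and let $$\Lambda_n=\mathrm{diag}\{\lambda_{n,1},\dots,\lambda_{n,k},1,\dots,1\}\in\mathbb{R}^{p\times p},\qquad \lambda_{n,1},\dots,\lambda_{n,k}>1 .$$ Suppose that $\sup_n\max_{i\le k(n)}\lambda_{n,i}<\infty$ and that $k=o(p)$ as $n\to\infty$. Let $U_n$ be any $p\times p$ real orthogonal matrices. Then the matrices $\Sigma_n=U_n\Lambda_nU_n^{\top}$ have regular eigenvectors in the following sense. Definition (regularity of eigenvectors). Let $\Sigma_n$ be positive semidefinite real $p\times p$ matrices, with any spectral decompositions $\Sigma_n=V_nM_nV_n^{\top}$, where $V_n$ is orthogonal and $M_n$ is diagonal. Let $H_n=p^{-1}\sum_{j=1}^p\delta_{(M_n)_{jj}}$ be the spectral distribution of $\Sigma_n$, and let $t_n(z)=\int\frac{1}{x-z}\,d\mathcal F(H_n,\gamma_n)(x)$, $z\in\mathbb C\setminus\mathbb R$, be the Stieltjes transform of $\mathcal F(H_n,\gamma_n)$.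 Here $\mathcal F$ is the Marčenko–Pastur map: $\mathcal F(H,\gamma)$ is the probability distribution whose Stieltjes transform $t$ satisfies, for all $z$ with $\Im z>0$, $$t(z)=\int\frac{1}{x\{1-\gamma-\gamma z t(z)\}-z}\,dH(x),\qquad \Im\Big\{-\frac{1-\gamma}{z}+\gamma t(z)\Big\}>0 .$$ For $z\in\mathbb C\setminus\mathbb R$ and $\ell\in\{1,2\}$ define $$\Gamma_{n,\ell}(z)=M_n^{1/2}\big[-zI_p+\{(1-\gamma_n)-z\gamma_nt_n(z)\}M_n\big]^{-\ell}M_n^{1/2}.$$ The eigenvectors are regular if the matrix in square brackets is always invertible and, for all fixed $z_1,z_2\in\mathbb C\setminus\mathbb R$ and each $\ell\in\{1,2\}$, as $n\to\infty$, $$\frac1p\sum_{j=1}^p\{V_n\Gamma_{n,\ell}(z_1)V_n^{\top}\}_{jj}\{V_n\Gamma_{n,2}(z_2)V_n^{\top}\}_{jj}=\frac1p\sum_{j=1}^p\{\Gamma_{n,\ell}(z_1)\}_{jj}\{\Gamma_{n,2}(z_2)\}_{jj}+o(1).$$ -/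

import Mathlib

open MeasureTheory Filter Topology

namespace SpikedCovariance

noncomputable section

/-- The Stieltjes transform `z ↦ ∫ 1 / (x - z) dμ(x)` of a measure on the real line. -/
abbrev stieltjesTransform (μ : Measure ℝ) (z : ℂ) : ℂ := resolventTransform μ z

/-- The spectral distribution `H = p⁻¹ ∑ⱼ δ_{Λⱼ}` of a matrix with eigenvalues `Λ₁, …, Λₚ`,
listed with multiplicity. -/
def spectralDistribution {p : ℕ} (Λ : Fin p → ℝ) : Measure ℝ :=
  ENNReal.ofReal (1 / p) • ∑ j, Measure.dirac (Λ j)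

/-- `μ` is the limiting spectral distribution of sample covariance matrices with limiting
population spectral distribution `H` and limiting aspect ratio `γ`: it is the probability
distribution whose Stieltjes transform `t` solves the Marchenko–Pastur equation
`t = ∫ 1 / (x (1 - γ - γ z t) - z) dH(x)` on the upper half-plane, `t = t(z)` being the solution
in the set where `-(1 - γ) / z + γ t` has positive imaginary part. -/
def IsMarchenkoPastur (H : Measure ℝ) (γ : ℝ) (μ : Measure ℝ) : Prop :=
  IsProbabilityMeasure μ ∧
    ∀ z : ℂ, 0 < z.im →
      0 < (-(1 - (γ : ℂ)) / z + γ * stieltjesTransform μ z).im ∧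
      stieltjesTransform μ z =
        ∫ x : ℝ, 1 / ((x : ℂ) * (1 - γ - γ * z * stieltjesTransform μ z) - z) ∂H

open Classical in
/-- The Marchenko–Pastur map `(H, γ) ↦ 𝓕(H, γ)`. By the classical theory, the distribution
described by `IsMarchenkoPastur` exists and is unique whenever `H` is a probability distribution
on `[0, ∞)` and `γ > 0`; the value `0` is a placeholder for other arguments. -/
def marchenkoPasturMap (H : Measure ℝ) (γ : ℝ) : Measure ℝ :=
  if h : ∃ μ : Measure ℝ, IsMarchenkoPastur H γ μ then h.choose else 0

/-- The matrix `-z I + {(1 - γ) - z γ t(z)} Λ`, with `t` the Stieltjes transform of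
`𝓕(H, γ)` and `H` the spectral distribution of `Λ`. -/
def middleFactor {p : ℕ} (γ : ℝ) (Λ : Fin p → ℝ) (z : ℂ) : Matrix (Fin p) (Fin p) ℂ :=
  (-z) • (1 : Matrix (Fin p) (Fin p) ℂ) +
    ((1 - (γ : ℂ)) -
        z * γ * stieltjesTransform (marchenkoPasturMap (spectralDistribution Λ) γ) z) •
      Matrix.diagonal (fun i => (Λ i : ℂ))

/-- The matrix `Γ_ℓ(z) = Λ^{1/2} [-z I + {(1 - γ) - z γ t(z)} Λ]^{-ℓ} Λ^{1/2}`. -/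
def Gam {p : ℕ} (γ : ℝ) (Λ : Fin p → ℝ) (ℓ : ℕ) (z : ℂ) : Matrix (Fin p) (Fin p) ℂ :=
  Matrix.diagonal (fun i => ((√(Λ i) : ℝ) : ℂ)) * (middleFactor γ Λ z)⁻¹ ^ ℓ *
    Matrix.diagonal (fun i => ((√(Λ i) : ℝ) : ℂ))

/-- The matrix `U Γ_ℓ(z) Uᵀ`. -/
def conjGam {p : ℕ} (U : Matrix (Fin p) (Fin p) ℝ) (γ : ℝ) (Λ : Fin p → ℝ) (ℓ : ℕ) (z : ℂ) :
    Matrix (Fin p) (Fin p) ℂ :=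
  U.map (fun x : ℝ => (x : ℂ)) * Gam γ Λ ℓ z * (U.map (fun x : ℝ => (x : ℂ))).transpose

/-- Regularity of eigenvectors of a sequence of `p(n) × p(n)` covariance matrices `Σₙ`, with
aspect ratio `γₙ = p(n) / n`. The condition is required for every spectral decomposition
`Σₙ = Uₙ Λₙ Uₙᵀ`, and includes that the inverses in `Γ_{n,ℓ}(z)` are genuine. -/
def EigenvectorRegularity (p : ℕ → ℕ) (S : ∀ n, Matrix (Fin (p n)) (Fin (p n)) ℝ) : Prop :=
  (∀ n, (S n).PosSemidef) ∧
  ∀ (U : ∀ n, Matrix (Fin (p n)) (Fin (p n)) ℝ) (Λ : ∀ n, Fin (p n) → ℝ),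
    (∀ n, U n ∈ Matrix.orthogonalGroup (Fin (p n)) ℝ) →
    (∀ n, S n = U n * Matrix.diagonal (Λ n) * (U n).transpose) →
    (∀ (n : ℕ) (z : ℂ), z.im ≠ 0 → IsUnit (middleFactor ((p n : ℝ) / n) (Λ n) z)) ∧
    ∀ z₁ z₂ : ℂ, z₁.im ≠ 0 → z₂.im ≠ 0 → ∀ ℓ : ℕ, ℓ = 1 ∨ ℓ = 2 →
      Tendsto (fun n : ℕ =>
        (1 / (p n : ℂ)) * ∑ j, conjGam (U n) ((p n : ℝ) / n) (Λ n) ℓ z₁ j j *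
            conjGam (U n) ((p n : ℝ) / n) (Λ n) 2 z₂ j j -
        (1 / (p n : ℂ)) * ∑ j, Gam ((p n : ℝ) / n) (Λ n) ℓ z₁ j j *
            Gam ((p n : ℝ) / n) (Λ n) 2 z₂ j j) atTop (𝓝 0)

end

end SpikedCovariance

/-!
Write `w(z) = (1 - γ) - z γ t(z)`. The Marchenko–Pastur equation forces `Im w(z)` and `Im z` to have
opposite signs, so `|-z + w(z) x| ≥ |Im z|` for every `x ≥ 0`. Hence the brackets are invertible and
`Γ_ℓ(z)` is diagonal, with entries `x (-z + w(z) x)^{-ℓ}` at the eigenvalues `x` that are bounded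
uniformly in `n`.

The diagonal of `U diag(f) Uᵀ` is `W f` for the doubly stochastic matrix `W = (U i j ^ 2)`. Because
`W` fixes constants and preserves sums, replacing `f` by `f - c` does not change
`∑ (W f) (W g) - ∑ f g`. If `f = c` outside `T`, the `ℓ¹`–`ℓ^∞` bound makes this difference
`O(#T)`, and here `T` indexes the `o(p)` spikes.
-/

namespace SpikedCovariance

open scoped Finset

section RowAverage

variable {ι : Type*} [Fintype ι]

/-- The vector `W f` for a real matrix `W` and a vector `f` with entries in a real vector space;
its entries are averages of `f` when `W` is row stochastic. -/
def rowAverage {E : Type*} [AddCommMonoid E] [Module ℝ E] (W : Matrix ι ι ℝ) (f : ι → E)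
    (i : ι) : E :=
  ∑ j, W i j • f j

lemma norm_rowAverage_le_rowAverage_norm {E : Type*} [SeminormedAddCommGroup E]
    [NormedSpace ℝ E] {W : Matrix ι ι ℝ} (hW : ∀ i j, 0 ≤ W i j) (f : ι → E) (i : ι) :
    ‖rowAverage W f i‖ ≤ rowAverage W (fun j => ‖f j‖) i :=
  norm_sum_le_of_le _ fun j _ => by rw [norm_smul_of_nonneg (hW i j), smul_eq_mul]

lemma norm_sum_mul_le_sum_norm_mul {A : Type*} [NonUnitalSeminormedRing A] {f g : ι → A} {B : ℝ}
    (hg : ∀ i, ‖g i‖ ≤ B) : ‖∑ i, f i * g i‖ ≤ (∑ i, ‖f i‖) * B := by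
  rw [Finset.sum_mul]
  exact norm_sum_le_of_le _ fun i _ =>
    (norm_mul_le _ _).trans (mul_le_mul_of_nonneg_left (hg i) (norm_nonneg _))

lemma exists_const_sum_norm_sub_le {E : Type*} [SeminormedAddCommGroup E] {f : ι → E} {c : E}
    {B : ℝ} {T : Finset ι} (hf : ∀ i, ‖f i‖ ≤ B) (hT : ∀ i ∉ T, f i = c) :
    ∃ d : E, ∑ i, ‖f i - d‖ ≤ 2 * B * #T := by
  obtain ⟨d, hd, hdT⟩ : ∃ d : E, (∀ i, ‖f i - d‖ ≤ 2 * B) ∧ ∀ i ∉ T, f i = d := by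
    by_cases hne : ∃ i₀, i₀ ∉ T
    · obtain ⟨i₀, hi₀⟩ := hne
      refine ⟨f i₀, fun i => ?_, fun i hi => (hT i hi).trans (hT i₀ hi₀).symm⟩
      linarith [norm_sub_le (f i) (f i₀), hf i, hf i₀]
    · refine ⟨0, fun i => ?_, fun i hi => absurd ⟨i, hi⟩ hne⟩
      rw [sub_zero]
      linarith [norm_nonneg (f i), hf i]
  refine ⟨d, ?_⟩
  calc ∑ i, ‖f i - d‖ = ∑ i ∈ T, ‖f i - d‖ := by
        refine (Finset.sum_subset T.subset_univ fun i _ hi => ?_).symm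
        rw [hdT i hi, sub_self, norm_zero]
    _ ≤ #T • (2 * B) := Finset.sum_le_card_nsmul _ _ _ fun i _ => hd i
    _ = 2 * B * #T := by rw [nsmul_eq_mul, mul_comm]

variable [DecidableEq ι] {W : Matrix ι ι ℝ}

lemma sum_rowAverage {E : Type*} [AddCommMonoid E] [Module ℝ E]
    (hW : W ∈ Matrix.colStochastic ℝ ι) (f : ι → E) : ∑ i, rowAverage W f i = ∑ i, f i := by
  simp only [rowAverage]
  rw [Finset.sum_comm]
  simp only [← Finset.sum_smul, Matrix.sum_col_of_mem_colStochastic hW, one_smul]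

lemma rowAverage_sub_const {E : Type*} [AddCommGroup E] [Module ℝ E]
    (hW : W ∈ Matrix.rowStochastic ℝ ι) (f : ι → E) (c : E) (i : ι) :
    rowAverage W (fun j => f j - c) i = rowAverage W f i - c := by
  simp only [rowAverage, smul_sub, Finset.sum_sub_distrib, ← Finset.sum_smul,
    Matrix.sum_row_of_mem_rowStochastic hW, one_smul]

section Norm

variable {E : Type*} [SeminormedAddCommGroup E] [NormedSpace ℝ E]

lemma norm_rowAverage_le (hW : W ∈ Matrix.rowStochastic ℝ ι) {f : ι → E} {B : ℝ}
    (hf : ∀ i, ‖f i‖ ≤ B) (i : ι) : ‖rowAverage W f i‖ ≤ B :=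
  calc ‖rowAverage W f i‖ ≤ ∑ j, W i j * ‖f j‖ := norm_rowAverage_le_rowAverage_norm hW.1 f i
    _ ≤ ∑ j, W i j * B :=
      Finset.sum_le_sum fun j _ => mul_le_mul_of_nonneg_left (hf j) (hW.1 i j)
    _ = B := by rw [← Finset.sum_mul, Matrix.sum_row_of_mem_rowStochastic hW, one_mul]

lemma sum_norm_rowAverage_le (hW : W ∈ Matrix.colStochastic ℝ ι) (f : ι → E) :
    ∑ i, ‖rowAverage W f i‖ ≤ ∑ i, ‖f i‖ :=
  (Finset.sum_le_sum fun i _ => norm_rowAverage_le_rowAverage_norm hW.1 f i).trans_eq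
    (sum_rowAverage hW _)

end Norm

lemma sum_rowAverage_mul_sub_eq {A : Type*} [Ring A] [Module ℝ A]
    (hW : W ∈ doublyStochastic ℝ ι) (f g : ι → A) (c : A) :
    ∑ i, rowAverage W f i * rowAverage W g i - ∑ i, f i * g i =
      ∑ i, rowAverage W (fun j => f j - c) i * rowAverage W g i - ∑ i, (f i - c) * g i := by
  obtain ⟨hrow, hcol⟩ := mem_doublyStochastic_iff_mem_rowStochastic_and_mem_colStochastic.mp hW
  simp only [rowAverage_sub_const hrow, sub_mul, Finset.sum_sub_distrib, ← Finset.mul_sum,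
    sum_rowAverage hcol, sub_sub_sub_cancel_right]

lemma norm_sum_rowAverage_mul_sub_le {A : Type*} [SeminormedRing A] [NormedSpace ℝ A]
    (hW : W ∈ doublyStochastic ℝ ι) {f g : ι → A} {c : A} {B D : ℝ} {T : Finset ι}
    (hf : ∀ i, ‖f i‖ ≤ B) (hg : ∀ i, ‖g i‖ ≤ D) (hT : ∀ i ∉ T, f i = c) :
    ‖∑ i, rowAverage W f i * rowAverage W g i - ∑ i, f i * g i‖ ≤ 4 * B * D * #T := by
  obtain ⟨hrow, hcol⟩ := mem_doublyStochastic_iff_mem_rowStochastic_and_mem_colStochastic.mp hW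
  rcases isEmpty_or_nonempty ι with hι | ⟨⟨i₀⟩⟩
  · simp [Finset.eq_empty_of_isEmpty]
  have hD : 0 ≤ D := (norm_nonneg _).trans (hg i₀)
  obtain ⟨d, hd⟩ := exists_const_sum_norm_sub_le hf hT
  rw [sum_rowAverage_mul_sub_eq hW f g d]
  calc _ ≤ (∑ i, ‖rowAverage W (fun j => f j - d) i‖) * D + (∑ i, ‖f i - d‖) * D :=
        norm_sub_le_of_le (norm_sum_mul_le_sum_norm_mul (norm_rowAverage_le hrow hg))
          (norm_sum_mul_le_sum_norm_mul hg)
    _ ≤ (2 * B * #T) * D + (2 * B * #T) * D := by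
        gcongr
        exact (sum_norm_rowAverage_le hcol _).trans hd
    _ = 4 * B * D * #T := by ring

end RowAverage

section Orthogonal

variable {ι : Type*} [Fintype ι]

lemma exists_perm_eq_comp_of_map_univ_eq {α : Type*} {f g : ι → α}
    (h : Finset.univ.val.map f = Finset.univ.val.map g) : ∃ σ : Equiv.Perm ι, f = g ∘ σ := by
  classical
  have hfiber (a : α) : Fintype.card {i // f i = a} = Fintype.card {i // g i = a} := by
    have hcount (φ : ι → α) : Fintype.card {i // φ i = a} = (Finset.univ.val.map φ).count a := by
      rw [Multiset.count_map, Fintype.card_subtype]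
      simp only [eq_comm]
      rfl
    rw [hcount, hcount, h]
  exact ⟨Equiv.ofFiberEquiv fun a => Fintype.equivOfCardEq (hfiber a),
    funext fun i => (Equiv.ofFiberEquiv_map _ i).symm⟩

variable [DecidableEq ι]

lemma map_sq_mem_doublyStochastic {U : Matrix ι ι ℝ} (hU : U ∈ Matrix.orthogonalGroup ι ℝ) :
    U.map (· ^ 2) ∈ doublyStochastic ℝ ι := by
  refine mem_doublyStochastic_iff_sum.mpr ⟨fun i j => sq_nonneg _, fun i => ?_, fun j => ?_⟩
  · simpa [Matrix.mul_apply, sq] using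
      congrFun₂ ((Matrix.mem_orthogonalGroup_iff _ _).mp hU) i i
  · simpa [Matrix.mul_apply, sq] using
      congrFun₂ ((Matrix.mem_orthogonalGroup_iff' _ _).mp hU) j j

lemma conj_diagonal_apply_self (U : Matrix ι ι ℝ) (f : ι → ℂ) (i : ι) :
    (U.map (fun x : ℝ => (x : ℂ)) * Matrix.diagonal f *
      (U.map (fun x : ℝ => (x : ℂ))).transpose) i i = rowAverage (U.map (· ^ 2)) f i := by
  rw [Matrix.mul_apply]
  refine Finset.sum_congr rfl fun j _ => ?_
  rw [Matrix.mul_diagonal, Matrix.transpose_apply, Matrix.map_apply, Matrix.map_apply,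
    Complex.real_smul, Complex.ofReal_pow]
  ring

variable {R : Type*} [CommRing R]

lemma charpoly_conj_diagonal {U : Matrix ι ι R} (hU : U ∈ Matrix.orthogonalGroup ι R)
    (Λ : ι → R) :
    (U * Matrix.diagonal Λ * U.transpose).charpoly =
      ∏ i, (Polynomial.X - Polynomial.C (Λ i)) := by
  rw [Matrix.charpoly_mul_comm, ← mul_assoc, (Matrix.mem_orthogonalGroup_iff' _ _).mp hU, one_mul,
    Matrix.charpoly_diagonal]

lemma exists_perm_eq_comp_of_conj_diagonal_eq [IsDomain R] {U V : Matrix ι ι R}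
    (hU : U ∈ Matrix.orthogonalGroup ι R) (hV : V ∈ Matrix.orthogonalGroup ι R) {Λ M : ι → R}
    (h : U * Matrix.diagonal Λ * U.transpose = V * Matrix.diagonal M * V.transpose) :
    ∃ σ : Equiv.Perm ι, M = Λ ∘ σ := by
  have hroots {W : Matrix ι ι R} (hW : W ∈ Matrix.orthogonalGroup ι R) (L : ι → R) :
      (W * Matrix.diagonal L * W.transpose).charpoly.roots = Finset.univ.val.map L := by
    rw [charpoly_conj_diagonal hW, ← Polynomial.roots_multiset_prod_X_sub_C
      (Finset.univ.val.map L), Multiset.map_map]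
    rfl
  exact exists_perm_eq_comp_of_map_univ_eq (by rw [← hroots hV, ← hroots hU, h])

end Orthogonal

section Shrinkage

lemma im_integral_nonpos {α : Type*} [MeasurableSpace α] {μ : Measure α} {f : α → ℂ}
    (hf : ∀ᵐ x ∂μ, (f x).im ≤ 0) : (∫ x, f x ∂μ).im ≤ 0 := by
  by_cases hint : Integrable f μ
  · exact (integral_im hint).symm.trans_le (integral_nonpos_of_ae hf)
  · rw [integral_undef hint, Complex.zero_im]

lemma im_inv_one_add_mul_nonpos {s : ℂ} (hs : 0 ≤ s.im) {x : ℝ} (hx : 0 ≤ x) :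
    ((1 + s * x)⁻¹).im ≤ 0 := by
  rw [Complex.inv_im]
  refine div_nonpos_of_nonpos_of_nonneg ?_ (Complex.normSq_nonneg _)
  simpa using mul_nonneg hs hx

lemma stieltjesTransform_conj (μ : Measure ℝ) (z : ℂ) :
    stieltjesTransform μ (starRingEnd ℂ z) = starRingEnd ℂ (stieltjesTransform μ z) := by
  rw [stieltjesTransform, stieltjesTransform, resolventTransform_apply, resolventTransform_apply,
    ← integral_conj]
  simp [resolvent, Ring.inverse_eq_inv']

lemma IsMarchenkoPastur.im_one_sub_sub_nonpos {H μ : Measure ℝ} {γ : ℝ}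
    (hμ : IsMarchenkoPastur H γ μ) (hγ : 0 ≤ γ) (hH : ∀ᵐ x ∂H, 0 ≤ x) {z : ℂ} (hz : 0 < z.im) :
    ((1 - (γ : ℂ)) - z * γ * stieltjesTransform μ z).im ≤ 0 := by
  have hz0 : z ≠ 0 := by rintro rfl; simp at hz
  obtain ⟨hs, ht⟩ := hμ.2 z hz
  set t := stieltjesTransform μ z
  set s := -(1 - (γ : ℂ)) / z + γ * t with hs_def
  have hzs : 1 - γ - γ * z * t = -(z * s) := by
    rw [hs_def]; field_simp; ring
  have hzt : z * t = -∫ x : ℝ, (1 + s * x)⁻¹ ∂H := by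
    rw [ht, hzs, ← integral_const_mul, ← integral_neg]
    congr 1 with x
    rw [show (x : ℂ) * -(z * s) - z = -z * (1 + s * x) by ring, one_div, mul_inv, inv_neg,
      neg_mul, mul_neg, mul_inv_cancel_left₀ hz0]
  have hw : (1 - (γ : ℂ)) - z * γ * t = ((1 - γ : ℝ) : ℂ) + γ * ∫ x : ℝ, (1 + s * x)⁻¹ ∂H := by
    push_cast
    linear_combination -(γ : ℂ) * hzt
  rw [hw, Complex.add_im, Complex.ofReal_im, zero_add, Complex.im_ofReal_mul]
  refine mul_nonpos_of_nonneg_of_nonpos hγ (im_integral_nonpos ?_)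
  filter_upwards [hH] with x hx using im_inv_one_add_mul_nonpos hs.le hx

/-- The coefficient `w(z) = (1 - γ) - z γ t(z)` of the population covariance matrix in the
deterministic equivalent of the sample resolvent, `t` being the Stieltjes transform of `𝓕(H, γ)`. -/
noncomputable def shrinkage (H : Measure ℝ) (γ : ℝ) (z : ℂ) : ℂ :=
  (1 - (γ : ℂ)) - z * γ * stieltjesTransform (marchenkoPasturMap H γ) z

lemma shrinkage_conj (H : Measure ℝ) (γ : ℝ) (z : ℂ) :
    shrinkage H γ (starRingEnd ℂ z) = starRingEnd ℂ (shrinkage H γ z) := by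
  simp only [shrinkage, stieltjesTransform_conj, map_sub, map_mul, map_one, Complex.conj_ofReal]

variable {H : Measure ℝ} {γ : ℝ}

lemma im_shrinkage_nonpos (hγ : 0 ≤ γ) (hH : ∀ᵐ x ∂H, 0 ≤ x) {z : ℂ} (hz : 0 < z.im) :
    (shrinkage H γ z).im ≤ 0 := by
  rw [shrinkage, marchenkoPasturMap]
  split_ifs with h
  · exact h.choose_spec.im_one_sub_sub_nonpos hγ hH hz
  ·
    simp [stieltjesTransform]

lemma im_shrinkage_mul_im_nonpos (hγ : 0 ≤ γ) (hH : ∀ᵐ x ∂H, 0 ≤ x) (z : ℂ) :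
    (shrinkage H γ z).im * z.im ≤ 0 := by
  rcases lt_trichotomy z.im 0 with hz | hz | hz
  · have hconj := im_shrinkage_nonpos hγ hH (z := starRingEnd ℂ z) (by simpa using hz)
    rw [shrinkage_conj, Complex.conj_im, neg_nonpos] at hconj
    exact mul_nonpos_of_nonneg_of_nonpos hconj hz.le
  · rw [hz, mul_zero]
  · exact mul_nonpos_of_nonpos_of_nonneg (im_shrinkage_nonpos hγ hH hz) hz.le

end Shrinkage

section SpectralFunction

variable {w z : ℂ} {x : ℝ}

lemma abs_im_le_norm_neg_add_mul (hwz : w.im * z.im ≤ 0) (hx : 0 ≤ x) :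
    |z.im| ≤ ‖-z + w * x‖ := by
  refine le_trans (sq_le_sq.mp ?_) (Complex.abs_im_le_norm _)
  rw [Complex.add_im, Complex.neg_im, Complex.im_mul_ofReal]
  nlinarith [mul_nonneg hx (neg_nonneg.mpr hwz), sq_nonneg (w.im * x)]

lemma neg_add_mul_ne_zero (hwz : w.im * z.im ≤ 0) (hz : z.im ≠ 0) (hx : 0 ≤ x) :
    -z + w * x ≠ 0 :=
  norm_pos_iff.mp ((abs_pos.mpr hz).trans_le (abs_im_le_norm_neg_add_mul hwz hx))

/-- The spectral function `x ↦ x (-z + w x)^{-ℓ}`, whose values at the eigenvalues of the population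
covariance matrix are, for `w = shrinkage H γ z`, the diagonal entries of `Γ_ℓ(z)`. -/
noncomputable def spectralFunction (w z : ℂ) (ℓ : ℕ) (x : ℝ) : ℂ :=
  x * (-z + w * x)⁻¹ ^ ℓ

lemma norm_spectralFunction_le (hwz : w.im * z.im ≤ 0) (hz : z.im ≠ 0) (ℓ : ℕ) (hx : 0 ≤ x)
    {C : ℝ} (hxC : x ≤ C) : ‖spectralFunction w z ℓ x‖ ≤ C * |z.im|⁻¹ ^ ℓ := by
  rw [spectralFunction, norm_mul, norm_pow, norm_inv, Complex.norm_real, Real.norm_of_nonneg hx]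
  have hdenom := abs_im_le_norm_neg_add_mul hwz hx
  gcongr
  exact hx.trans hxC

end SpectralFunction

section Gamma

variable {p : ℕ} {γ : ℝ} {Λ : Fin p → ℝ}

lemma ae_spectralDistribution_nonneg (hΛ : ∀ i, 0 ≤ Λ i) :
    ∀ᵐ x ∂spectralDistribution Λ, 0 ≤ x := by
  refine Measure.ae_smul_measure (ae_finsetSum_measure_iff.mpr fun i _ => ?_) _
  rw [ae_dirac_eq]
  exact hΛ i

lemma middleFactor_eq_diagonal (γ : ℝ) (Λ : Fin p → ℝ) (z : ℂ) :
    middleFactor γ Λ z =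
      Matrix.diagonal fun i => -z + shrinkage (spectralDistribution Λ) γ z * Λ i := by
  rw [middleFactor, ← shrinkage, Matrix.smul_one_eq_diagonal, ← Matrix.diagonal_smul,
    Matrix.diagonal_add]
  rfl

lemma isUnit_middleFactor (hγ : 0 ≤ γ) (hΛ : ∀ i, 0 ≤ Λ i) {z : ℂ} (hz : z.im ≠ 0) :
    IsUnit (middleFactor γ Λ z) := by
  have hw := im_shrinkage_mul_im_nonpos hγ (ae_spectralDistribution_nonneg hΛ) z
  rw [middleFactor_eq_diagonal, Matrix.isUnit_diagonal, Pi.isUnit_iff]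
  exact fun i => (neg_add_mul_ne_zero hw hz (hΛ i)).isUnit

lemma gam_eq_diagonal (hΛ : ∀ i, 0 ≤ Λ i) {z : ℂ} (hunit : IsUnit (middleFactor γ Λ z)) (ℓ : ℕ) :
    Gam γ Λ ℓ z = Matrix.diagonal fun i =>
      spectralFunction (shrinkage (spectralDistribution Λ) γ z) z ℓ (Λ i) := by
  rw [middleFactor_eq_diagonal, Matrix.isUnit_diagonal] at hunit
  have hinv : (middleFactor γ Λ z)⁻¹ = Matrix.diagonal fun i =>
      (-z + shrinkage (spectralDistribution Λ) γ z * Λ i)⁻¹ := by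
    refine Matrix.inv_eq_right_inv ?_
    rw [middleFactor_eq_diagonal, Matrix.diagonal_mul_diagonal, ← Matrix.diagonal_one]
    congr 1 with i
    exact mul_inv_cancel₀ (Pi.isUnit_iff.mp hunit i).ne_zero
  rw [Gam, hinv, Matrix.diagonal_pow, Matrix.diagonal_mul_diagonal, Matrix.diagonal_mul_diagonal]
  congr 1 with i
  have hsq : ((√(Λ i) : ℝ) : ℂ) * ((√(Λ i) : ℝ) : ℂ) = Λ i := by
    rw [← Complex.ofReal_mul, Real.mul_self_sqrt (hΛ i)]
  rw [spectralFunction, Pi.pow_apply, mul_right_comm, hsq]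

lemma norm_average_conjGam_mul_sub_le (hγ : 0 ≤ γ) {U : Matrix (Fin p) (Fin p) ℝ}
    (hU : U ∈ Matrix.orthogonalGroup (Fin p) ℝ) (hΛ : ∀ i, 0 ≤ Λ i) {C : ℝ} (hC : ∀ i, Λ i ≤ C)
    (c : ℝ) {z₁ z₂ : ℂ} (hz₁ : z₁.im ≠ 0) (hz₂ : z₂.im ≠ 0) (ℓ m : ℕ) :
    ‖(1 / (p : ℂ)) * ∑ j, conjGam U γ Λ ℓ z₁ j j * conjGam U γ Λ m z₂ j j -
      (1 / (p : ℂ)) * ∑ j, Gam γ Λ ℓ z₁ j j * Gam γ Λ m z₂ j j‖ ≤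
    4 * (C * |z₁.im|⁻¹ ^ ℓ) * (C * |z₂.im|⁻¹ ^ m) * (#{i | Λ i ≠ c} / p) := by
  have hbound {z : ℂ} (hz : z.im ≠ 0) (q : ℕ) (i : Fin p) :
      ‖spectralFunction (shrinkage (spectralDistribution Λ) γ z) z q (Λ i)‖ ≤
        C * |z.im|⁻¹ ^ q :=
    norm_spectralFunction_le (im_shrinkage_mul_im_nonpos hγ (ae_spectralDistribution_nonneg hΛ) z)
      hz q (hΛ i) (hC i)
  simp only [conjGam, gam_eq_diagonal hΛ (isUnit_middleFactor hγ hΛ hz₁),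
    gam_eq_diagonal hΛ (isUnit_middleFactor hγ hΛ hz₂), conj_diagonal_apply_self,
    Matrix.diagonal_apply_eq]
  rw [← mul_sub, norm_mul, norm_div, norm_one, Complex.norm_natCast, one_div_mul_eq_div,
    ← mul_div_assoc]
  gcongr
  refine norm_sum_rowAverage_mul_sub_le
    (c := spectralFunction (shrinkage (spectralDistribution Λ) γ z₁) z₁ ℓ c)
    (map_sq_mem_doublyStochastic hU) (hbound hz₁ ℓ) (hbound hz₂ m) fun i hi => ?_
  rw [show Λ i = c by simpa using hi]

end Gamma

lemma card_ne_le_of_forall_le {α : Type*} [DecidableEq α] {p k : ℕ} {f : Fin p → α} {c : α}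
    (hf : ∀ i : Fin p, k ≤ (i : ℕ) → f i = c) : #{i | f i ≠ c} ≤ k := by
  refine (Finset.card_le_card_of_injOn (t := Finset.range k) Fin.val (fun i hi => ?_)
    Fin.val_injective.injOn).trans_eq (Finset.card_range k)
  have hi : f i ≠ c := by simpa using hi
  exact Finset.mem_coe.mpr (Finset.mem_range.mpr (lt_of_not_ge fun hk => hi (hf i hk)))

end SpikedCovariance

open SpikedCovariance
open scoped Finset

theorem proposition4p1_general (p : ℕ → ℕ) (Λ : ∀ n, Fin (p n) → ℝ) (hΛ : ∀ n i, 0 ≤ Λ n i)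
    (hbdd : ∃ C : ℝ, ∀ (n : ℕ) (i : Fin (p n)), Λ n i ≤ C) (c : ℕ → ℝ)
    (hc : (fun n => (#{i | Λ n i ≠ c n} : ℝ)) =o[atTop] (fun n => (p n : ℝ)))
    (U : ∀ n, Matrix (Fin (p n)) (Fin (p n)) ℝ)
    (hU : ∀ n, U n ∈ Matrix.orthogonalGroup (Fin (p n)) ℝ) :
    EigenvectorRegularity p (fun n => U n * Matrix.diagonal (Λ n) * (U n).transpose) := by
  obtain ⟨C, hC⟩ := hbdd
  have hγ (n : ℕ) : 0 ≤ (p n : ℝ) / n := by positivity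
  refine ⟨fun n => ?_, fun V M hV hM => ?_⟩
  · have hpsd := (Matrix.PosSemidef.diagonal (hΛ n)).mul_mul_conjTranspose_same (U n)
    rwa [Matrix.conjTranspose_eq_transpose_of_trivial] at hpsd
  choose σ hσ using fun n => exists_perm_eq_comp_of_conj_diagonal_eq (hU n) (hV n) (hM n)
  obtain rfl : M = fun n => Λ n ∘ σ n := funext hσ
  have hcard (n : ℕ) : #{i | Λ n (σ n i) ≠ c n} = #{i | Λ n i ≠ c n} :=
    Finset.card_equiv (σ n) (by simp)
  refine ⟨fun n z hz => isUnit_middleFactor (hγ n) (fun i => hΛ n (σ n i)) hz,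
    fun z₁ z₂ hz₁ hz₂ ℓ _ => squeeze_zero_norm (fun n => norm_average_conjGam_mul_sub_le (hγ n)
      (hV n) (fun i => hΛ n (σ n i)) (fun i => hC n (σ n i)) (c n) hz₁ hz₂ ℓ 2) ?_⟩
  simp only [hcard]
  simpa only [mul_zero] using hc.tendsto_div_nhds_zero.const_mul
    (4 * (C * |z₁.im|⁻¹ ^ ℓ) * (C * |z₂.im|⁻¹ ^ 2))

theorem proposition4p1 (p k : ℕ → ℕ) (hkp : ∀ n, k n ≤ p n)
    (Λ : ∀ n, Fin (p n) → ℝ)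
    (hspike : ∀ (n : ℕ) (i : Fin (p n)), (i : ℕ) < k n → 1 < Λ n i)
    (hone : ∀ (n : ℕ) (i : Fin (p n)), k n ≤ (i : ℕ) → Λ n i = 1)
    (hbdd : ∃ C : ℝ, ∀ (n : ℕ) (i : Fin (p n)), Λ n i ≤ C)
    (hk : (fun n => (k n : ℝ)) =o[atTop] (fun n => (p n : ℝ)))
    (U : ∀ n, Matrix (Fin (p n)) (Fin (p n)) ℝ)
    (hU : ∀ n, U n ∈ Matrix.orthogonalGroup (Fin (p n)) ℝ) :
    SpikedCovariance.EigenvectorRegularity p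
      (fun n => U n * Matrix.diagonal (Λ n) * (U n).transpose) := by
  have hone_le (n : ℕ) (i : Fin (p n)) : 1 ≤ Λ n i :=
    (lt_or_ge (i : ℕ) (k n)).elim (fun hi => (hspike n i hi).le) fun hi => (hone n i hi).ge
  have hcard : (fun n => (#{i | Λ n i ≠ 1} : ℝ)) =o[atTop] (fun n => (p n : ℝ)) :=
    (Asymptotics.IsBigO.of_norm_le fun n => by
      simpa using card_ne_le_of_forall_le (hone n)).trans_isLittleO hk
  exact proposition4p1_general p Λ (fun n i => zero_le_one.trans (hone_le n i)) hbdd 1 hcard U hU
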